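/- **Setting.** Let $I=[0,1]$, let $d_I$ be a metric on $I$ inducing the usual topology, let $\theta\in(0,1)$, and put on $\Omega=I^{\mathbb Z}$ the metric $d(x,y)=\sup_{k\in\mathbb Z}\theta^{|k|}d_I(x_k,y_k)$. Let $\tau:I\to I$ have full branches: there are $0=a_0<a_1<\dots<a_b=1$ and homeomorphisms $\zeta_j:I\to[a_{j-1},a_j]$ $(1\le j\le b)$, the inverse branches, with $\tau\circ\zeta_j=\mathrm{id}$ on $\zeta_j^{-1}((a_{j-1},a_j))$, and at a partition point $\tau$ takes one of its one-sided limit values. Let $\tau$ be expanding: for some $\eta\in(0,1)$, $d_I(\zeta_j x,\zeta_j y)\le\eta\, d_I(x,y)$ for all $j,x,y$. Fix a point $p$ with $\tau(p)=p$. For $k\ge 0$ let $\pi_k x\in\Omega$ agree with $x$ at the sites $|i|\le k$ and equal $p$ at all other sites. Fix $\beta>0$, let $$|\Phi|_\beta=\sup_{k}\sup_{x\ne y}\frac{|\Phi(\pi_kx)-\Phi(\pi_ky)|}{d(x,y)^\beta},$$ and let $\mathcal C$ be the space of continuous (real- or complex-valued) functions $\Phi$ on $\Omega$ with $|\Phi|_\beta<\infty$.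 Let $f\in\mathcal C$ be real-valued. For continuous $\Phi$ put $$P\Phi(x)=\lim_{k\to\infty}b^{-(2k+1)}\sum_{\omega\in\{1,\dots,b\}^{\{-k,\dots,k\}}}e^{f(\pi_k\zeta_\omega x)}\,\Phi(\pi_k\zeta_\omega x),$$ where $(\zeta_\omega x)_i=\zeta_{\omega_i}(x_i)$ for $|i|\le k$ and $(\zeta_\omega x)_i=x_i$ otherwise. Let $\nu$ be a Borel probability measure on $\Omega$ and $\lambda\in\mathbb R$ with $P^*\nu=\lambda\nu$, i.e. $\int P\Phi\,d\nu=\lambda\int\Phi\,d\nu$ for all real $\Phi\in C(\Omega)$. Let $h\in C(\Omega)$ satisfy $Ph=\lambda h$, $h\ge0$, $\int h\,d\nu=1$ and $$h(x)\le \exp\Big(|f|_\beta\tfrac{\eta^\beta}{1-\eta^\beta}d(x,y)^\beta\Big)h(y)\quad\text{for all }x,y\in\Omega.$$ Put $L\Phi=P(h\Phi)/(\lambda h)$. Let $E:\Omega\to\Omega$ be a bijection and $C_E\in(0,\eta^{-1})$ with $d(\sigma^nE^{-1}x,\sigma^nE^{-1}y)\le C_E\,d(\sigma^nx,\sigma^ny)$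 for all $n\in\mathbb Z$ and $x,y\in\Omega$, where $(\sigma^n x)_i=x_{i+n}$. Put $\mathcal L\Phi(x)=(L\Phi)(E^{-1}x)$. **Statement.** $\mathcal L$ is a well-defined linear operator on $\mathcal C$. The constant function $\mathbb 1$ is an eigenfunction of $\mathcal L$ with eigenvalue $1$, and the eigenvalue $1$ is simple: its geometric multiplicity $\dim\ker(\mathcal L-1)$ and its algebraic multiplicity $\dim\bigcup_{m\ge1}\ker(\mathcal L-1)^m$ are both $1$. Moreover, every nonnegative eigenfunction of $\mathcal L$ with eigenvalue $1$ vanishes nowhere. -/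

import Mathlib

open MeasureTheory Filter Topology
open scoped ENNReal

noncomputable section

/-- The lattice space `I^ℤ` (with its product topology and product sigma-algebra). -/
abbrev LatticeSpace : Type := ℤ → unitInterval

/-- A site system: a metric `dI` on the unit interval inducing the usual topology, a weight
`θ ∈ (0,1)`, and an expanding map `τ` of the unit interval with full branches, together with
one fixed point `p` of `τ`.

Full branches: there is a partition `0 = a 0 < a 1 < ⋯ < a b = 1` such that on each open interval
`(a j, a (j+1))` the map `τ` is the inverse of a homeomorphism `ζ j` from the unit interval
onto `[a j, a (j+1)]`, the `j`-th inverse branch; at a partition point `τ` takes one of its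
one-sided limit values. All of this is expressed by `branch_range` and `branch_map` together:
distinct branches have images that meet in at most an end point. -/
structure LatticeSystem where
  /-- the metric on the unit interval -/
  dI : unitInterval → unitInterval → ℝ
  dI_eq_zero : ∀ x y, dI x y = 0 ↔ x = y
  dI_symm : ∀ x y, dI x y = dI y x
  dI_triangle : ∀ x y z, dI x z ≤ dI x y + dI y z
  isOpen_iff : ∀ s : Set unitInterval,
    IsOpen s ↔ ∀ x ∈ s, ∃ ε > 0, ∀ y, dI x y < ε → y ∈ s
  /-- the weight in the metric on the lattice space -/
  θ : ℝ
  θ_pos : 0 < θ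
  θ_lt_one : θ < 1
  /-- the map at a single site -/
  τ : unitInterval → unitInterval
  /-- the number of branches -/
  b : ℕ
  /-- the partition points -/
  a : Fin (b + 1) → unitInterval
  a_strictMono : StrictMono a
  a_zero : a 0 = 0
  a_last : a (Fin.last b) = 1
  /-- the inverse branches -/
  ζ : Fin b → unitInterval → unitInterval
  branch_continuous : ∀ j, Continuous (ζ j)
  branch_injective : ∀ j, Function.Injective (ζ j)
  branch_range : ∀ j, Set.range (ζ j) = Set.Icc (a j.castSucc) (a j.succ)
  branch_map : ∀ x, ∃ j, ζ j (τ x) = x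
  /-- the contraction rate of the inverse branches -/
  η : ℝ
  η_pos : 0 < η
  η_lt_one : η < 1
  branch_contract : ∀ j x y, dI (ζ j x) (ζ j y) ≤ η * dI x y
  /-- a fixed point of `τ` -/
  p : unitInterval
  map_p : τ p = p

/-- The `n`-th power of the left shift on the lattice space. -/
def latticeShift (n : ℤ) (x : LatticeSpace) : LatticeSpace := fun i => x (i + n)

namespace LatticeSystem

variable (S : LatticeSystem)

/-- The metric `d(x, y) = sup_k θ^|k| dI(x_k, y_k)` on the lattice space. -/
def d (x y : LatticeSpace) : ℝ := ⨆ k : ℤ, S.θ ^ k.natAbs * S.dI (x k) (y k)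

/-- The projection `π_k`: keep the sites `|i| ≤ k`, put the fixed point `p` elsewhere. -/
def proj (k : ℕ) (x : LatticeSpace) : LatticeSpace := fun i => if i.natAbs ≤ k then x i else S.p

/-- The Hölder constant `|Φ|_β = sup_k sup_{x,y} |Φ(π_k x) - Φ(π_k y)| / d(x,y)^β`,
possibly infinite (pairs `x = y` contribute `0 / 0 = 0`). -/
def holderConst {𝕜 : Type*} [RCLike 𝕜] (β : ℝ) (Φ : LatticeSpace → 𝕜) : ℝ≥0∞ :=
  ⨆ (k : ℕ) (x : LatticeSpace) (y : LatticeSpace),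
    ENNReal.ofReal (‖Φ (S.proj k x) - Φ (S.proj k y)‖ / S.d x y ^ β)

theorem dI_nonneg (x y : unitInterval) : 0 ≤ S.dI x y := by
  have h1 := S.dI_triangle x y x
  have h2 := (S.dI_eq_zero x x).2 rfl
  have h3 := S.dI_symm x y
  linarith

theorem d_nonneg (x y : LatticeSpace) : 0 ≤ S.d x y :=
  Real.iSup_nonneg fun _ => mul_nonneg (pow_nonneg S.θ_pos.le _) (S.dI_nonneg _ _)

theorem le_holderConst {𝕜 : Type*} [RCLike 𝕜] (β : ℝ) (Φ : LatticeSpace → 𝕜) (k : ℕ)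
    (x y : LatticeSpace) :
    ENNReal.ofReal (‖Φ (S.proj k x) - Φ (S.proj k y)‖ / S.d x y ^ β) ≤ S.holderConst β Φ := by
  unfold holderConst
  exact le_iSup_of_le k (le_iSup_of_le x (le_iSup_of_le y le_rfl))

theorem holderConst_add_le {𝕜 : Type*} [RCLike 𝕜] (β : ℝ) (Φ Ψ : LatticeSpace → 𝕜) :
    S.holderConst β (Φ + Ψ) ≤ S.holderConst β Φ + S.holderConst β Ψ := by
  refine iSup_le fun k => iSup_le fun x => iSup_le fun y => ?_
  have hd : 0 ≤ S.d x y ^ β := Real.rpow_nonneg (S.d_nonneg x y) β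
  calc ENNReal.ofReal (‖(Φ + Ψ) (S.proj k x) - (Φ + Ψ) (S.proj k y)‖ / S.d x y ^ β)
      ≤ ENNReal.ofReal (‖Φ (S.proj k x) - Φ (S.proj k y)‖ / S.d x y ^ β
          + ‖Ψ (S.proj k x) - Ψ (S.proj k y)‖ / S.d x y ^ β) := by
        apply ENNReal.ofReal_le_ofReal
        rw [← add_div]
        refine div_le_div_of_nonneg_right ?_ hd
        simp only [Pi.add_apply, add_sub_add_comm]
        exact norm_add_le _ _
    _ ≤ _ := ENNReal.ofReal_add_le
    _ ≤ _ := add_le_add (S.le_holderConst β Φ k x y) (S.le_holderConst β Ψ k x y)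

theorem holderConst_smul_le {𝕜 : Type*} [RCLike 𝕜] (β : ℝ) (c : 𝕜) (Φ : LatticeSpace → 𝕜) :
    S.holderConst β (c • Φ) ≤ ENNReal.ofReal ‖c‖ * S.holderConst β Φ := by
  refine iSup_le fun k => iSup_le fun x => iSup_le fun y => ?_
  have : ‖(c • Φ) (S.proj k x) - (c • Φ) (S.proj k y)‖ / S.d x y ^ β
      = ‖c‖ * (‖Φ (S.proj k x) - Φ (S.proj k y)‖ / S.d x y ^ β) := by
    simp only [Pi.smul_apply, ← smul_sub, norm_smul, mul_div_assoc]
  rw [this, ENNReal.ofReal_mul (norm_nonneg c)]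
  gcongr
  exact S.le_holderConst β Φ k x y

/-- The space `𝒞` of continuous functions on the lattice space with finite Hölder constant
(the supremum norm is automatically finite since the lattice space is compact). -/
def holderSpace (𝕜 : Type*) [RCLike 𝕜] (β : ℝ) : Submodule 𝕜 C(LatticeSpace, 𝕜) where
  carrier := {Φ | S.holderConst β Φ < ⊤}
  zero_mem' := by simp [holderConst]
  add_mem' {Φ Ψ} hΦ hΨ :=
    (S.holderConst_add_le β Φ Ψ).trans_lt (ENNReal.add_lt_top.2 ⟨hΦ, hΨ⟩)
  smul_mem' c Φ hΦ :=
    (S.holderConst_smul_le β c Φ).trans_lt (ENNReal.mul_lt_top ENNReal.ofReal_lt_top hΦ)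

/-- The constant function `1` as an element of `𝒞`. -/
def oneFun (𝕜 : Type*) [RCLike 𝕜] (β : ℝ) : S.holderSpace 𝕜 β :=
  ⟨1, by
    change S.holderConst β (⇑(1 : C(LatticeSpace, 𝕜))) < ⊤
    simp [holderConst]⟩

/-- The inverse branch of the product map on the sites `|i| ≤ k` given by a choice `ω` of an
inverse branch of `τ` at each of these sites; the other sites are left unchanged. -/
def invBranch (k : ℕ) (ω : Finset.Icc (-(k : ℤ)) k → Fin S.b) (x : LatticeSpace) : LatticeSpace :=
  fun i => if hi : i ∈ Finset.Icc (-(k : ℤ)) k then S.ζ (ω ⟨i, hi⟩) (x i) else x i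

/-- The transfer operator `P_k` of the finite lattice `{-k, …, k}` for the potential `f`. -/
def finTransfer {𝕜 : Type*} [RCLike 𝕜] (f : LatticeSpace → ℝ) (k : ℕ) (Φ : LatticeSpace → 𝕜)
    (x : LatticeSpace) : 𝕜 :=
  (1 / (S.b : 𝕜) ^ (2 * k + 1)) * ∑ ω : Finset.Icc (-(k : ℤ)) k → Fin S.b,
    ((Real.exp (f (S.proj k (S.invBranch k ω x))) : ℝ) : 𝕜) * Φ (S.proj k (S.invBranch k ω x))

/-- The transfer operator `P`, the pointwise limit of `P_k` (the limit exists for all continuous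
`f` and `Φ`, see `tendsto_finTransfer`). -/
def transfer {𝕜 : Type*} [RCLike 𝕜] (f : LatticeSpace → ℝ) (Φ : LatticeSpace → 𝕜) (x : LatticeSpace) : 𝕜 :=
  limUnder atTop fun k : ℕ => S.finTransfer f k Φ x

theorem exists_agree {𝕜 : Type*} [RCLike 𝕜] (G : C(LatticeSpace, 𝕜)) {ε : ℝ} (hε : 0 < ε) :
    ∃ K : ℕ, ∀ y z : LatticeSpace, (∀ i : ℤ, i.natAbs ≤ K → y i = z i) → dist (G y) (G z) < ε := by
  have hu := CompactSpace.uniformContinuous_of_continuous G.continuous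
  have hV := hu (Metric.dist_mem_uniformity hε)
  rw [Pi.uniformity, Filter.mem_map, Filter.mem_iInf] at hV
  obtain ⟨I, hI, V, hV, he⟩ := hV
  obtain ⟨K, hK⟩ := (hI.image Int.natAbs).bddAbove
  refine ⟨K, fun y z h => ?_⟩
  have : (y, z) ∈ ⋂ i, V i := by
    refine Set.mem_iInter.2 fun i => ?_
    obtain ⟨W, hW, hWV⟩ := Filter.mem_comap.1 (hV i)
    apply hWV
    have := h i (hK ⟨i, i.2, rfl⟩)
    simp only [Set.mem_preimage, this]
    exact refl_mem_uniformity hW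
  rw [← he] at this
  exact this

theorem avg_restrict {𝕜 : Type*} [RCLike 𝕜] (b : ℕ) (hb : 0 < b) {k l : ℕ}
    (hs : Finset.Icc (-(k : ℤ)) k ⊆ Finset.Icc (-(l : ℤ)) l)
    (g : (Finset.Icc (-(k : ℤ)) k → Fin b) → 𝕜) :
    (1 / (b : 𝕜) ^ (2 * k + 1)) * ∑ ω, g ω =
    (1 / (b : 𝕜) ^ (2 * l + 1)) * ∑ ω : Finset.Icc (-(l : ℤ)) l → Fin b,
      g (fun i => ω ⟨i.1, hs i.2⟩) := by
  classical
  let e0 : {i : Finset.Icc (-(l : ℤ)) l // i.1 ∈ Finset.Icc (-(k : ℤ)) k} ≃ Finset.Icc (-(k : ℤ)) k :=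
    ⟨fun i => ⟨i.1.1, i.2⟩, fun i => ⟨⟨i.1, hs i.2⟩, i.2⟩, fun _ => rfl, fun _ => rfl⟩
  let e := (Equiv.piEquivPiSubtypeProd (fun i : Finset.Icc (-(l : ℤ)) l => i.1 ∈ Finset.Icc (-(k : ℤ)) k)
    (fun _ => Fin b)).trans (Equiv.prodCongr (Equiv.arrowCongr e0 (Equiv.refl _)) (Equiv.refl _))
  have hc : Fintype.card (Finset.Icc (-(l : ℤ)) l → Fin b) = Fintype.card (Finset.Icc (-(k : ℤ)) k → Fin b)
     * Fintype.card ({i : Finset.Icc (-(l : ℤ)) l // ¬ i.1 ∈ Finset.Icc (-(k : ℤ)) k} → Fin b) := by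
    rw [Fintype.card_congr e, Fintype.card_prod]
  have card : ∀ m : ℕ, Fintype.card (Finset.Icc (-(m : ℤ)) m → Fin b) = b ^ (2 * m + 1) := by
    intro m
    rw [Fintype.card_fun, Fintype.card_fin, Fintype.card_coe, Int.card_Icc]
    congr 1; omega
  rw [card, card] at hc
  have hs : ∑ ω : Finset.Icc (-(l : ℤ)) l → Fin b, g (fun i => ω ⟨i.1, hs i.2⟩)
      = ∑ q : (Finset.Icc (-(k : ℤ)) k → Fin b) × ({i : Finset.Icc (-(l : ℤ)) l // ¬ i.1 ∈ Finset.Icc (-(k : ℤ)) k} → Fin b), g q.1 :=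
    Fintype.sum_equiv e _ _ fun ω => rfl
  rw [hs, Fintype.sum_prod_type]
  simp only [Finset.sum_const, Finset.card_univ, nsmul_eq_mul]
  rw [← Finset.mul_sum, ← mul_assoc]
  congr 1
  have hb' : (b : 𝕜) ≠ 0 := by exact_mod_cast hb.ne'
  have hc' := congrArg (Nat.cast : ℕ → 𝕜) hc
  push_cast at hc'
  rw [hc']
  have : ((Fintype.card ({i : Finset.Icc (-(l : ℤ)) l // ¬ i.1 ∈ Finset.Icc (-(k : ℤ)) k} → Fin b) : ℕ) : 𝕜) ≠ 0 := by
    intro h0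
    rw [h0, mul_zero] at hc'
    exact pow_ne_zero _ hb' hc'
  field_simp

theorem b_pos : 0 < S.b := by
  obtain ⟨j, -⟩ := S.branch_map 0
  exact j.pos

theorem tendsto_finTransfer {𝕜 : Type*} [RCLike 𝕜] (f : C(LatticeSpace, ℝ))
    (Φ : C(LatticeSpace, 𝕜)) (x : LatticeSpace) :
    Tendsto (fun k : ℕ => S.finTransfer f k Φ x) atTop (𝓝 (S.transfer f Φ x)) := by
  refine CauchySeq.tendsto_limUnder (Metric.cauchySeq_iff'.2 fun ε hε => ?_)
  let G : C(LatticeSpace, 𝕜) := ⟨fun y => ((Real.exp (f y) : ℝ) : 𝕜) * Φ y, by fun_prop⟩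
  obtain ⟨K, hK⟩ := exists_agree G (half_pos hε)
  refine ⟨K, fun l hl => ?_⟩
  have hs : Finset.Icc (-(K : ℤ)) K ⊆ Finset.Icc (-(l : ℤ)) l := by
    apply Finset.Icc_subset_Icc <;> omega
  have hb := S.b_pos
  have hbR : (0 : ℝ) < (S.b : ℝ) ^ (2 * l + 1) := by positivity
  unfold finTransfer
  rw [avg_restrict S.b hb hs, dist_eq_norm, ← mul_sub, ← Finset.sum_sub_distrib, norm_mul]
  refine lt_of_le_of_lt (mul_le_mul_of_nonneg_left (norm_sum_le_of_le (f := fun ω => _) Finset.univ (n := fun _ => ε / 2) fun ω _ => ?_) (norm_nonneg _)) ?_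
  · rw [← dist_eq_norm]
    refine (hK _ _ fun i hi => ?_).le
    have h1 : i ∈ Finset.Icc (-(K : ℤ)) K := by rw [Finset.mem_Icc]; omega
    have h2 : i ∈ Finset.Icc (-(l : ℤ)) l := hs h1
    have h3 : i.natAbs ≤ l := hi.trans hl
    simp only [proj, invBranch, hi, h3, h1, h2, if_true, dif_pos]
  · have hcard : Fintype.card (Finset.Icc (-(l : ℤ)) l → Fin S.b) = S.b ^ (2 * l + 1) := by
      rw [Fintype.card_fun, Fintype.card_fin, Fintype.card_coe, Int.card_Icc]
      congr 1; omega
    rw [Finset.sum_const, Finset.card_univ, hcard]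
    simp only [norm_div, norm_one, norm_pow, RCLike.norm_natCast, nsmul_eq_mul, Nat.cast_pow]
    field_simp
    linarith

/-- `P^* ν = lam ν` as functionals on `C(Ω)`. -/
def IsEigenmeasure (f : LatticeSpace → ℝ) (ν : Measure LatticeSpace) (lam : ℝ) : Prop :=
  ∀ Φ : C(LatticeSpace, ℝ), ∫ x, S.transfer f Φ x ∂ν = lam * ∫ x, Φ x ∂ν

/-- `B(z) = exp(|f|_β η^β / (1 - η^β) z^β)`. -/
def distortion (β : ℝ) (f : LatticeSpace → ℝ) (z : ℝ) : ℝ :=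
  Real.exp ((S.holderConst β f).toReal * (S.η ^ β / (1 - S.η ^ β)) * z ^ β)

/-- The set `Δ_f` of nonnegative continuous functions `Φ` with `ν(Φ) = 1` and
`Φ(x) ≤ B(d(x,y)) Φ(y)` for all `x, y`. -/
def Delta (β : ℝ) (f : LatticeSpace → ℝ) (ν : Measure LatticeSpace) : Set C(LatticeSpace, ℝ) :=
  {Φ | (∀ x, 0 ≤ Φ x) ∧ ∫ x, Φ x ∂ν = 1 ∧
    ∀ x y, Φ x ≤ S.distortion β f (S.d x y) * Φ y}

/-- The normalized transfer operator `L Φ = P(h Φ) / (lam h)`. -/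
def normTransfer {𝕜 : Type*} [RCLike 𝕜] (f : LatticeSpace → ℝ) (lam : ℝ) (h : LatticeSpace → ℝ)
    (Φ : LatticeSpace → 𝕜) (x : LatticeSpace) : 𝕜 :=
  S.transfer f (fun y => (h y : 𝕜) * Φ y) x / ((lam * h x : ℝ) : 𝕜)

/-- The transfer operator of the coupled map, `(ℒ Φ)(x) = (L Φ)(E⁻¹ x)`. -/
def coupledTransfer {𝕜 : Type*} [RCLike 𝕜] (f : LatticeSpace → ℝ) (lam : ℝ) (h : LatticeSpace → ℝ)
    (E : LatticeSpace ≃ LatticeSpace) (Φ : LatticeSpace → 𝕜) (x : LatticeSpace) : 𝕜 :=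
  S.normTransfer f lam h Φ (E.symm x)

end LatticeSystem

end

noncomputable section

namespace LatticeSystem

variable (S : LatticeSystem)

/-! ### The metric on the lattice space -/

/-! The operator `ℒ` is positive and satisfies `ℒ 1 = 1`, because `Ph = λh` and `h > 0`. So it obeys
a maximum principle. The heart of the proof is that zeros spread. If `v ≥ 0` is fixed and `v x = 0`,
then `v` vanishes at every preimage `ζ_ω (E⁻¹ x)`, where `ω` chooses a branch at every site
(`transfer_pos`, `eq_zero_of_coupledTransfer_eq_zero`). Each step `x ↦ ζ_ω (E⁻¹ x)` contracts `d` by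
`η C_E < 1` and the full branches cover `Ω`, so the iterated preimages of one zero are dense and `v
= 0` (`eq_zero_of_fixed`).

For real Hölder `u` with `ℒu = u + c`, comparing at a maximum of `u` and of `-u` gives `c = 0`. Then
`max u - u` is a nonnegative fixed function with a zero, so `u` is constant
(`eq_of_coupledTransfer_eq_add`). The case `c = 0` gives geometric multiplicity one; the exclusion
of `c ≠ 0` rules out a Jordan block. The complex case reduces to real and imaginary parts, since
`f`, `λ` and `h` are real.

`ℒ` preserves `𝒞` because membership in `𝒞` is ordinary `β`-Hölder continuity for `d`
(`mem_holderSpace_iff`), and `h` and `1/h` are Hölder since `log h` is. -/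

theorem isOpen_ball_dI (x : unitInterval) (r : ℝ) : IsOpen {y | S.dI x y < r} := by
  refine (S.isOpen_iff _).2 fun y hy => ⟨r - S.dI x y, sub_pos.2 hy, fun z hz => ?_⟩
  have := S.dI_triangle x y z
  change S.dI x z < r
  linarith

/-- Compactness: the open balls of integer radius about `0` have a finite subcover. -/
theorem exists_dI_le : ∃ D : ℝ, ∀ x y, S.dI x y ≤ D := by
  obtain ⟨t, ht⟩ := isCompact_univ.elim_finite_subcover
    (fun n : ℕ => {y | S.dI 0 y < n}) (fun n => S.isOpen_ball_dI 0 n)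
    (fun y _ => Set.mem_iUnion.2 (exists_nat_gt (S.dI 0 y)))
  have key : ∀ y, S.dI 0 y ≤ t.sup id := by
    intro y
    obtain ⟨n, hn, hy⟩ := Set.mem_iUnion₂.1 (ht (Set.mem_univ y))
    have h1 : n ≤ t.sup id := Finset.le_sup (f := id) hn
    have h2 : (n : ℝ) ≤ (t.sup id : ℕ) := by exact_mod_cast h1
    exact (le_of_lt hy).trans h2
  refine ⟨t.sup id + t.sup id, fun x y => ?_⟩
  have := S.dI_triangle x 0 y
  rw [S.dI_symm x 0] at this
  linarith [key x, key y]

theorem bddAbove_d (x y : LatticeSpace) :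
    BddAbove (Set.range fun k : ℤ => S.θ ^ k.natAbs * S.dI (x k) (y k)) := by
  obtain ⟨D, hD⟩ := S.exists_dI_le
  refine ⟨D, ?_⟩
  rintro _ ⟨k, rfl⟩
  exact (mul_le_of_le_one_left (S.dI_nonneg _ _)
    (pow_le_one₀ S.θ_pos.le S.θ_lt_one.le)).trans (hD _ _)

theorem le_d (x y : LatticeSpace) (k : ℤ) : S.θ ^ k.natAbs * S.dI (x k) (y k) ≤ S.d x y :=
  le_ciSup (S.bddAbove_d x y) k

theorem d_le {x y : LatticeSpace} {c : ℝ}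
    (h : ∀ k : ℤ, S.θ ^ k.natAbs * S.dI (x k) (y k) ≤ c) : S.d x y ≤ c :=
  ciSup_le h

theorem exists_d_le : ∃ D : ℝ, 0 ≤ D ∧ ∀ x y, S.d x y ≤ D := by
  obtain ⟨D, hD⟩ := S.exists_dI_le
  refine ⟨D, (S.dI_nonneg 0 0).trans (hD 0 0), fun x y => S.d_le fun k => ?_⟩
  exact (mul_le_of_le_one_left (S.dI_nonneg _ _)
    (pow_le_one₀ S.θ_pos.le S.θ_lt_one.le)).trans (hD _ _)

theorem d_comm (x y : LatticeSpace) : S.d x y = S.d y x := by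
  simp only [d, S.dI_symm]

theorem eq_of_d_eq_zero {x y : LatticeSpace} (h : S.d x y = 0) : x = y := by
  funext k
  have h1 := S.le_d x y k
  have h2 : 0 < S.θ ^ k.natAbs := pow_pos S.θ_pos _
  rw [h] at h1
  exact (S.dI_eq_zero _ _).1 (le_antisymm (nonpos_of_mul_nonpos_right h1 h2) (S.dI_nonneg _ _))

/-- The weight makes far sites contribute at most `θ ^ n * D`, so only finitely many coordinates
need to be close. -/
theorem eventually_d_lt (x : LatticeSpace) {ε : ℝ} (hε : 0 < ε) : ∀ᶠ y in 𝓝 x, S.d x y < ε := by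
  obtain ⟨D, hD⟩ := S.exists_dI_le
  have ht : Tendsto (fun n : ℕ => S.θ ^ n * D) atTop (𝓝 0) := by
    simpa using (tendsto_pow_atTop_nhds_zero_of_lt_one S.θ_pos.le S.θ_lt_one).mul_const D
  obtain ⟨K, hK⟩ := eventually_atTop.1 (ht.eventually (gt_mem_nhds (half_pos hε)))
  have h1 : ∀ᶠ y : LatticeSpace in 𝓝 x, ∀ i ∈ Finset.Icc (-(K : ℤ)) K,
      S.dI (x i) (y i) < ε / 2 := by
    refine (Filter.eventually_all_finset _).2 fun i _ => ?_
    have hx : S.dI (x i) (x i) < ε / 2 := by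
      rw [(S.dI_eq_zero _ _).2 rfl]
      exact half_pos hε
    exact (continuous_apply i).continuousAt.preimage_mem_nhds
      ((S.isOpen_ball_dI (x i) (ε / 2)).mem_nhds hx)
  filter_upwards [h1] with y hy
  refine lt_of_le_of_lt (S.d_le (c := ε / 2) fun k => ?_) (half_lt_self hε)
  by_cases hk : k.natAbs ≤ K
  · exact (mul_le_of_le_one_left (S.dI_nonneg _ _)
      (pow_le_one₀ S.θ_pos.le S.θ_lt_one.le)).trans (hy k (by rw [Finset.mem_Icc]; omega)).le
  · exact (mul_le_mul_of_nonneg_left (hD _ _) (pow_nonneg S.θ_pos.le _)).trans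
      (hK _ (by omega)).le

theorem d_proj_le (k : ℕ) (x y : LatticeSpace) : S.d (S.proj k x) (S.proj k y) ≤ S.d x y := by
  refine S.d_le fun i => ?_
  unfold proj
  split_ifs
  · exact S.le_d x y i
  · simpa [(S.dI_eq_zero _ _).2] using S.d_nonneg x y

theorem tendsto_proj (x : LatticeSpace) : Tendsto (fun k => S.proj k x) atTop (𝓝 x) := by
  refine tendsto_pi_nhds.2 fun i => tendsto_const_nhds.congr' ?_
  filter_upwards [eventually_ge_atTop i.natAbs] with k hk
  simp [proj, hk]

/-! ### Hölder continuous functions -/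

/-- Hölder continuity with exponent `β` with respect to the metric `d`. -/
def IsHolder {𝕜 : Type*} [RCLike 𝕜] (β : ℝ) (Φ : LatticeSpace → 𝕜) : Prop :=
  ∃ C : ℝ, 0 ≤ C ∧ ∀ x y, ‖Φ x - Φ y‖ ≤ C * S.d x y ^ β

variable {S} {𝕜 : Type*} [RCLike 𝕜] {β : ℝ}

theorem IsHolder.continuous {Φ : LatticeSpace → 𝕜} (hβ : 0 < β) (hΦ : S.IsHolder β Φ) :
    Continuous Φ := by
  obtain ⟨C, hC, h⟩ := hΦ
  refine continuous_iff_continuousAt.2 fun x => ?_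
  have hd : Tendsto (fun y => S.d y x) (𝓝 x) (𝓝 0) := by
    refine Metric.tendsto_nhds.2 fun ε hε => ?_
    filter_upwards [S.eventually_d_lt x hε] with y hy
    rwa [Real.dist_0_eq_abs, abs_of_nonneg (S.d_nonneg _ _), S.d_comm]
  have h0 : Tendsto (fun y => C * S.d y x ^ β) (𝓝 x) (𝓝 0) := by
    have := (hd.rpow_const (Or.inr hβ.le)).const_mul C
    rwa [Real.zero_rpow hβ.ne', mul_zero] at this
  exact tendsto_iff_norm_sub_tendsto_zero.2
    (squeeze_zero (fun _ => norm_nonneg _) (fun y => h y x) h0)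

/-- One direction lets `π_k x → x` in the uniform bound; the other holds because `π_k` does not
increase `d`. -/
theorem mem_holderSpace_iff (hβ : 0 < β) (Φ : C(LatticeSpace, 𝕜)) :
    Φ ∈ S.holderSpace 𝕜 β ↔ S.IsHolder β Φ := by
  constructor
  · intro hΦ
    change S.holderConst β Φ < ⊤ at hΦ
    refine ⟨(S.holderConst β Φ).toReal, ENNReal.toReal_nonneg, fun x y => ?_⟩
    rcases eq_or_ne x y with rfl | hxy
    · rw [sub_self, norm_zero]
      exact mul_nonneg ENNReal.toReal_nonneg (Real.rpow_nonneg (S.d_nonneg _ _) _)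
    have hd : 0 < S.d x y ^ β := Real.rpow_pos_of_pos
      (lt_of_le_of_ne (S.d_nonneg x y) fun h => hxy (S.eq_of_d_eq_zero h.symm)) β
    have hk : ∀ k, ‖Φ (S.proj k x) - Φ (S.proj k y)‖
        ≤ (S.holderConst β Φ).toReal * S.d x y ^ β := fun k => by
      rw [← div_le_iff₀ hd]
      exact (ENNReal.ofReal_le_iff_le_toReal hΦ.ne).1 (S.le_holderConst β Φ k x y)
    exact le_of_tendsto (((Φ.continuous.tendsto x).comp (S.tendsto_proj x)).sub
      ((Φ.continuous.tendsto y).comp (S.tendsto_proj y))).norm (Eventually.of_forall hk)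
  · rintro ⟨C, hC, h⟩
    change S.holderConst β Φ < ⊤
    refine lt_of_le_of_lt (iSup_le fun k => iSup_le fun x => iSup_le fun y => ?_)
      (ENNReal.ofReal_lt_top (r := C))
    refine ENNReal.ofReal_le_ofReal (div_le_of_le_mul₀ (Real.rpow_nonneg (S.d_nonneg _ _) _) hC
      ((h _ _).trans (mul_le_mul_of_nonneg_left ?_ hC)))
    exact Real.rpow_le_rpow (S.d_nonneg _ _) (S.d_proj_le k x y) hβ.le

theorem exists_norm_le (Φ : C(LatticeSpace, 𝕜)) : ∃ M : ℝ, 0 ≤ M ∧ ∀ x, ‖Φ x‖ ≤ M :=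
  ⟨‖Φ‖, norm_nonneg _, Φ.norm_coe_le_norm⟩

theorem IsHolder.exists_norm_le {Φ : LatticeSpace → 𝕜} (hβ : 0 < β) (hΦ : S.IsHolder β Φ) :
    ∃ M : ℝ, 0 ≤ M ∧ ∀ x, ‖Φ x‖ ≤ M :=
  LatticeSystem.exists_norm_le ⟨Φ, hΦ.continuous hβ⟩

theorem IsHolder.add {Φ Ψ : LatticeSpace → 𝕜} (hΦ : S.IsHolder β Φ) (hΨ : S.IsHolder β Ψ) :
    S.IsHolder β fun x => Φ x + Ψ x := by
  obtain ⟨C, hC, h⟩ := hΦ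
  obtain ⟨C', hC', h'⟩ := hΨ
  refine ⟨C + C', add_nonneg hC hC', fun x y => ?_⟩
  rw [add_sub_add_comm, add_mul]
  exact (norm_add_le _ _).trans (add_le_add (h x y) (h' x y))

theorem IsHolder.mul {Φ Ψ : LatticeSpace → 𝕜} (hβ : 0 < β) (hΦ : S.IsHolder β Φ)
    (hΨ : S.IsHolder β Ψ) : S.IsHolder β fun x => Φ x * Ψ x := by
  obtain ⟨M, hM, hb⟩ := hΦ.exists_norm_le hβ
  obtain ⟨M', hM', hb'⟩ := hΨ.exists_norm_le hβ
  obtain ⟨C, hC, h⟩ := hΦ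
  obtain ⟨C', hC', h'⟩ := hΨ
  refine ⟨M * C' + C * M', by positivity, fun x y => ?_⟩
  have hd : 0 ≤ S.d x y ^ β := Real.rpow_nonneg (S.d_nonneg _ _) _
  calc ‖Φ x * Ψ x - Φ y * Ψ y‖ = ‖Φ x * (Ψ x - Ψ y) + (Φ x - Φ y) * Ψ y‖ := by ring_nf
    _ ≤ ‖Φ x‖ * ‖Ψ x - Ψ y‖ + ‖Φ x - Φ y‖ * ‖Ψ y‖ := by
      simpa only [norm_mul] using norm_add_le (Φ x * (Ψ x - Ψ y)) ((Φ x - Φ y) * Ψ y)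
    _ ≤ M * (C' * S.d x y ^ β) + C * S.d x y ^ β * M' :=
      add_le_add (mul_le_mul (hb x) (h' x y) (norm_nonneg _) hM)
        (mul_le_mul (h x y) (hb' y) (norm_nonneg _) (by positivity))
    _ = _ := by ring

theorem IsHolder.neg {Φ : LatticeSpace → 𝕜} (hΦ : S.IsHolder β Φ) :
    S.IsHolder β fun x => -Φ x := by
  obtain ⟨C, hC, h⟩ := hΦ
  refine ⟨C, hC, fun x y => ?_⟩
  rw [neg_sub_neg, norm_sub_rev]
  exact h x y

theorem isHolder_const (c : 𝕜) : S.IsHolder β fun _ => c :=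
  ⟨0, le_rfl, fun x y => by simp⟩

theorem IsHolder.ofReal {g : LatticeSpace → ℝ} (hg : S.IsHolder β g) :
    S.IsHolder β fun x => (g x : 𝕜) := by
  obtain ⟨C, hC, h⟩ := hg
  refine ⟨C, hC, fun x y => ?_⟩
  rw [← RCLike.ofReal_sub, RCLike.norm_ofReal]
  exact h x y

theorem IsHolder.comp_clm {Φ : LatticeSpace → 𝕜} (hΦ : S.IsHolder β Φ) (T : 𝕜 →L[ℝ] ℝ) :
    S.IsHolder β fun x => T (Φ x) := by
  obtain ⟨C, hC, h⟩ := hΦ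
  refine ⟨‖T‖ * C, by positivity, fun x y => ?_⟩
  rw [← map_sub, mul_assoc]
  exact (T.le_opNorm _).trans (mul_le_mul_of_nonneg_left (h x y) (norm_nonneg _))

theorem IsHolder.comp_lipschitz {Φ : LatticeSpace → 𝕜} (hβ : 0 < β) (hΦ : S.IsHolder β Φ)
    {F : LatticeSpace → LatticeSpace} {c : ℝ} (hc : 0 ≤ c)
    (hF : ∀ x y, S.d (F x) (F y) ≤ c * S.d x y) : S.IsHolder β fun x => Φ (F x) := by
  obtain ⟨C, hC, h⟩ := hΦ
  refine ⟨C * c ^ β, mul_nonneg hC (Real.rpow_nonneg hc _), fun x y => (h _ _).trans ?_⟩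
  rw [mul_assoc, ← Real.mul_rpow hc (S.d_nonneg _ _)]
  exact mul_le_mul_of_nonneg_left (Real.rpow_le_rpow (S.d_nonneg _ _) (hF x y) hβ.le) hC

/-- This is `1 + t ≤ exp t` at `t = b - a`, multiplied by `exp a`. -/
theorem exp_sub_exp_le {a b M : ℝ} (ha : a ≤ M) :
    Real.exp a - Real.exp b ≤ Real.exp M * |a - b| := by
  have h1 : Real.exp b = Real.exp a * Real.exp (b - a) := by rw [← Real.exp_add]; ring_nf
  have h2 := Real.add_one_le_exp (b - a)
  calc Real.exp a - Real.exp b = Real.exp a * (1 - Real.exp (b - a)) := by rw [h1]; ring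
    _ ≤ Real.exp a * |a - b| :=
      mul_le_mul_of_nonneg_left (by linarith [le_abs_self (a - b)]) (Real.exp_pos _).le
    _ ≤ _ := mul_le_mul_of_nonneg_right (Real.exp_le_exp.2 ha) (abs_nonneg _)

theorem IsHolder.exp {g : LatticeSpace → ℝ} (hβ : 0 < β) (hg : S.IsHolder β g) :
    S.IsHolder β fun x => Real.exp (g x) := by
  obtain ⟨M, hM, hb⟩ := hg.exists_norm_le hβ
  obtain ⟨C, hC, h⟩ := hg
  refine ⟨Real.exp M * C, by positivity, fun x y => ?_⟩
  have hle : ∀ z, g z ≤ M := fun z => (le_abs_self _).trans (hb z)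
  have h1 := exp_sub_exp_le (b := g y) (hle x)
  have h2 := exp_sub_exp_le (b := g x) (hle y)
  rw [abs_sub_comm] at h2
  rw [mul_assoc]
  exact (abs_le.2 ⟨by linarith, h1⟩).trans
    (mul_le_mul_of_nonneg_left (h x y) (Real.exp_pos _).le)

/-! ### Inverse branches -/

variable (S) in
/-- The inverse branch of the product map given by a choice of a branch at every site. -/
def fullBranch (ω : ℤ → Fin S.b) (x : LatticeSpace) : LatticeSpace := fun i => S.ζ (ω i) (x i)

theorem d_fullBranch_le (ω : ℤ → Fin S.b) (x y : LatticeSpace) :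
    S.d (S.fullBranch ω x) (S.fullBranch ω y) ≤ S.η * S.d x y := by
  refine S.d_le fun i => ?_
  calc _ ≤ S.θ ^ i.natAbs * (S.η * S.dI (x i) (y i)) :=
        mul_le_mul_of_nonneg_left (S.branch_contract _ _ _) (pow_nonneg S.θ_pos.le _)
    _ = S.η * (S.θ ^ i.natAbs * S.dI (x i) (y i)) := by ring
    _ ≤ _ := mul_le_mul_of_nonneg_left (S.le_d x y i) S.η_pos.le

theorem d_proj_invBranch_le (k : ℕ) (ω : Finset.Icc (-(k : ℤ)) k → Fin S.b)
    (x y : LatticeSpace) :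
    S.d (S.proj k (S.invBranch k ω x)) (S.proj k (S.invBranch k ω y)) ≤ S.d x y := by
  refine S.d_le fun i => ?_
  by_cases hi : i.natAbs ≤ k
  · have h1 : i ∈ Finset.Icc (-(k : ℤ)) k := by rw [Finset.mem_Icc]; omega
    simp only [proj, invBranch, hi, h1, if_true, dif_pos]
    refine (mul_le_mul_of_nonneg_left ?_ (pow_nonneg S.θ_pos.le _)).trans (S.le_d x y i)
    exact (S.branch_contract _ _ _).trans
      (mul_le_of_le_one_left (S.dI_nonneg _ _) S.η_lt_one.le)
  · simpa [proj, hi, (S.dI_eq_zero _ _).2] using S.d_nonneg x y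

/-- The preimage point is `τ` applied sitewise, with the branch at each site taken from
`branch_map`. -/
theorem exists_fullBranch_eq (z : LatticeSpace) :
    ∃ (ω : ℤ → Fin S.b) (y : LatticeSpace), S.fullBranch ω y = z := by
  choose ω hω using fun i => S.branch_map (z i)
  exact ⟨ω, fun i => S.τ (z i), funext hω⟩

/-! ### The transfer operator -/

theorem card_branches (b m : ℕ) :
    Fintype.card (Finset.Icc (-(m : ℤ)) m → Fin b) = b ^ (2 * m + 1) := by
  rw [Fintype.card_fun, Fintype.card_fin, Fintype.card_coe, Int.card_Icc]
  congr 1; omega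

theorem norm_average_le (k : ℕ) {g : (Finset.Icc (-(k : ℤ)) k → Fin S.b) → 𝕜} {c : ℝ}
    (hg : ∀ ω, ‖g ω‖ ≤ c) : ‖(1 / (S.b : 𝕜) ^ (2 * k + 1)) * ∑ ω, g ω‖ ≤ c := by
  have hb : (0 : ℝ) < (S.b : ℝ) ^ (2 * k + 1) := by have := S.b_pos; positivity
  rw [norm_mul]
  refine (mul_le_mul_of_nonneg_left (norm_sum_le_of_le Finset.univ fun ω _ => hg ω)
    (norm_nonneg _)).trans (le_of_eq ?_)
  rw [Finset.sum_const, Finset.card_univ, card_branches]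
  simp only [norm_div, norm_one, norm_pow, RCLike.norm_natCast, nsmul_eq_mul, Nat.cast_pow]
  field_simp

/-- The finite averages share the Hölder constant of `exp f * Φ`, since the projected branches do
not increase `d`; the bound survives the limit. -/
theorem IsHolder.transfer {f : C(LatticeSpace, ℝ)} {Φ : C(LatticeSpace, 𝕜)} (hβ : 0 < β)
    (hf : S.IsHolder β f) (hΦ : S.IsHolder β Φ) : S.IsHolder β (S.transfer f Φ) := by
  obtain ⟨C, hC, h⟩ := ((hf.exp hβ).ofReal (𝕜 := 𝕜)).mul hβ hΦ
  refine ⟨C, hC, fun x y => ?_⟩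
  refine le_of_tendsto ((S.tendsto_finTransfer f Φ x).sub (S.tendsto_finTransfer f Φ y)).norm
    (Eventually.of_forall fun k => ?_)
  unfold finTransfer
  rw [← mul_sub, ← Finset.sum_sub_distrib]
  refine norm_average_le k fun ω => (h _ _).trans (mul_le_mul_of_nonneg_left ?_ hC)
  exact Real.rpow_le_rpow (S.d_nonneg _ _) (d_proj_invBranch_le k ω x y) hβ.le

/-- `transfer` is a `limUnder`, so identities are checked on the finite averages and carried over by
uniqueness of limits. -/
theorem transfer_add (f : C(LatticeSpace, ℝ)) (Φ Ψ : C(LatticeSpace, 𝕜)) (x : LatticeSpace) :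
    S.transfer f (fun y => Φ y + Ψ y) x = S.transfer f Φ x + S.transfer f Ψ x := by
  refine tendsto_nhds_unique (S.tendsto_finTransfer f (Φ + Ψ) x)
    (((S.tendsto_finTransfer f Φ x).add (S.tendsto_finTransfer f Ψ x)).congr fun k => ?_)
  simp only [finTransfer, ContinuousMap.add_apply]
  rw [← mul_add, ← Finset.sum_add_distrib]
  simp only [mul_add]

theorem transfer_mul_left (f : C(LatticeSpace, ℝ)) (c : 𝕜) (Φ : C(LatticeSpace, 𝕜))
    (x : LatticeSpace) : S.transfer f (fun y => c * Φ y) x = c * S.transfer f Φ x := by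
  refine tendsto_nhds_unique (S.tendsto_finTransfer f (c • Φ) x)
    (((S.tendsto_finTransfer f Φ x).const_mul c).congr fun k => ?_)
  simp only [finTransfer, ContinuousMap.smul_apply, smul_eq_mul, Finset.mul_sum]
  exact Finset.sum_congr rfl fun ω _ => by ring

theorem finTransfer_eq_smul (f : LatticeSpace → ℝ) (k : ℕ) (Φ : LatticeSpace → 𝕜)
    (x : LatticeSpace) : S.finTransfer f k Φ x = (1 / (S.b : ℝ) ^ (2 * k + 1)) •
      ∑ ω, Real.exp (f (S.proj k (S.invBranch k ω x))) • Φ (S.proj k (S.invBranch k ω x)) := by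
  simp [finTransfer, RCLike.real_smul_eq_coe_mul]

theorem clm_transfer (f : C(LatticeSpace, ℝ)) (T : 𝕜 →L[ℝ] ℝ) (Φ : C(LatticeSpace, 𝕜))
    (x : LatticeSpace) : T (S.transfer f Φ x) = S.transfer f (fun y => T (Φ y)) x := by
  refine tendsto_nhds_unique (((T.continuous.tendsto _).comp (S.tendsto_finTransfer f Φ x)))
    ((S.tendsto_finTransfer f (⟨fun y => T (Φ y), by fun_prop⟩ : C(LatticeSpace, ℝ)) x).congr
      fun k => ?_)
  simp only [finTransfer_eq_smul, Function.comp_apply, map_smul, map_sum, ContinuousMap.coe_mk]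

theorem transfer_nonneg (f g : C(LatticeSpace, ℝ)) (hg : ∀ x, 0 ≤ g x) (x : LatticeSpace) :
    0 ≤ S.transfer f g x := by
  refine ge_of_tendsto (S.tendsto_finTransfer f g x) (Eventually.of_forall fun k => ?_)
  rw [finTransfer_eq_smul]
  exact smul_nonneg (by positivity) (Finset.sum_nonneg fun ω _ =>
    smul_nonneg (Real.exp_pos _).le (hg _))

/-- A nonnegative function with a positive value at some preimage has a positive image. -/
theorem transfer_pos (f g : C(LatticeSpace, ℝ)) (hg : ∀ x, 0 ≤ g x) (x : LatticeSpace)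
    (ω : ℤ → Fin S.b) (hω : 0 < g (S.fullBranch ω x)) : 0 < S.transfer f g x := by
  classical
  let G : C(LatticeSpace, ℝ) := ⟨fun y => Real.exp (f y) * g y, by fun_prop⟩
  have hG : 0 < G (S.fullBranch ω x) := mul_pos (Real.exp_pos _) hω
  obtain ⟨K, hK⟩ := exists_agree G (half_pos hG)
  -- `G` exceeds `δ` at every point agreeing with `fullBranch ω x` on the sites `|i| ≤ K`.
  set δ := G (S.fullBranch ω x) / 2 with hδ
  have hb : (0 : ℝ) < (S.b : ℝ) ^ (2 * K + 1) := by have := S.b_pos; positivity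
  refine lt_of_lt_of_le (b := 1 / (S.b : ℝ) ^ (2 * K + 1) * δ)
    (mul_pos (one_div_pos.2 hb) (half_pos hG)) ?_
  refine ge_of_tendsto (S.tendsto_finTransfer f g x) ?_
  filter_upwards [eventually_ge_atTop K] with l hl
  have hs : Finset.Icc (-(K : ℤ)) K ⊆ Finset.Icc (-(l : ℤ)) l := by
    apply Finset.Icc_subset_Icc <;> omega
  -- Among branch choices on the larger window, exactly the fraction `b ^ -(2K+1)` restricts to `ω`
  -- on `|i| ≤ K`. This lower bound does not depend on `l`, so positivity survives the limit.
  have h1 := avg_restrict (𝕜 := ℝ) S.b S.b_pos hs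
    fun σ => if σ = (fun i => ω i.1) then δ else 0
  rw [Finset.sum_ite_eq' Finset.univ, if_pos (Finset.mem_univ _)] at h1
  rw [h1]
  unfold finTransfer
  refine mul_le_mul_of_nonneg_left (Finset.sum_le_sum fun σ _ => ?_) (by positivity)
  split_ifs with hσ
  · have h2 := hK (S.proj l (S.invBranch l σ x)) (S.fullBranch ω x) fun i hi => by
      have h1 : i ∈ Finset.Icc (-(K : ℤ)) K := by rw [Finset.mem_Icc]; omega
      have h3 : i.natAbs ≤ l := hi.trans hl
      have h4 : σ ⟨i, hs h1⟩ = ω i := congrFun hσ ⟨i, h1⟩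
      simp only [proj, invBranch, fullBranch, h3, hs h1, if_true, dif_pos, h4]
    rw [Real.dist_eq] at h2
    have h5 := (abs_lt.1 h2).1
    change δ ≤ G _
    linarith
  · exact mul_nonneg (Real.exp_pos _).le (hg _)

/-! ### The normalized transfer operator of the coupled map -/

/-- One point suffices; `exists_fullBranch_eq` only supplies a branch choice for `transfer_pos`. -/
theorem eigenvalue_pos {f h : C(LatticeSpace, ℝ)} {lam : ℝ} (hpos : ∀ x, 0 < h x) (hPh : ∀ x, S.transfer f h x = lam * h x) :
    0 < lam := by
  obtain ⟨ω, y, hy⟩ := S.exists_fullBranch_eq (fun _ => 0)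
  have := S.transfer_pos f h (fun x => (hpos x).le) y ω (hpos _)
  rw [hPh] at this
  exact pos_of_mul_pos_left this (hpos y).le

/-- By the distortion inequality one zero would force `h = 0` everywhere, against `∫ h dν = 1`. -/
theorem pos_of_mem_Delta {f : LatticeSpace → ℝ} {ν : Measure LatticeSpace}
    {h : C(LatticeSpace, ℝ)} (hΔ : h ∈ S.Delta β f ν) (x : LatticeSpace) : 0 < h x := by
  obtain ⟨h0, h1, h2⟩ := hΔ
  refine lt_of_le_of_ne (h0 x) fun hx => ?_
  have : ∀ y, h y = 0 := fun y => le_antisymm (by simpa [← hx] using h2 y x) (h0 y)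
  simp [this] at h1

theorem isHolder_log_of_mem_Delta {f : LatticeSpace → ℝ} {ν : Measure LatticeSpace}
    {h : C(LatticeSpace, ℝ)} (hβ : 0 < β) (hΔ : h ∈ S.Delta β f ν) :
    S.IsHolder β fun x => Real.log (h x) := by
  have hpos := pos_of_mem_Delta hΔ
  have hη : S.η ^ β < 1 := Real.rpow_lt_one S.η_pos.le S.η_lt_one hβ
  have hη0 : 0 ≤ S.η ^ β := Real.rpow_nonneg S.η_pos.le _
  set c := (S.holderConst β f).toReal * (S.η ^ β / (1 - S.η ^ β)) with hc
  have key : ∀ x y, Real.log (h x) - Real.log (h y) ≤ c * S.d x y ^ β := fun x y => by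
    have h1 := Real.log_le_log (hpos x) (hΔ.2.2 x y)
    rw [distortion, Real.log_mul (Real.exp_pos _).ne' (hpos y).ne', Real.log_exp] at h1
    linarith
  refine ⟨c, mul_nonneg ENNReal.toReal_nonneg (div_nonneg hη0 (sub_nonneg.2 hη.le)),
    fun x y => abs_le.2 ⟨?_, key x y⟩⟩
  have := key y x
  rw [S.d_comm] at this
  linarith

/-- The product of a continuous function with a real weight. -/
def weighted (h : C(LatticeSpace, ℝ)) (Φ : C(LatticeSpace, 𝕜)) : C(LatticeSpace, 𝕜) :=
  ⟨fun y => (h y : 𝕜) * Φ y, by fun_prop⟩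

/-- Bundles `h Φ` as a continuous map, the form in which the results on `transfer` apply. -/
theorem coupledTransfer_eq (f : LatticeSpace → ℝ) (lam : ℝ) (h : C(LatticeSpace, ℝ))
    (E : LatticeSpace ≃ LatticeSpace) (Φ : C(LatticeSpace, 𝕜)) (x : LatticeSpace) :
    S.coupledTransfer f lam h E Φ x =
      S.transfer f (weighted h Φ) (E.symm x) / ((lam * h (E.symm x) : ℝ) : 𝕜) := rfl

section Coupled

variable (f : C(LatticeSpace, ℝ)) (lam : ℝ) (h : C(LatticeSpace, ℝ))
  (E : LatticeSpace ≃ LatticeSpace)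

theorem coupledTransfer_add (Φ Ψ : C(LatticeSpace, 𝕜)) (x : LatticeSpace) :
    S.coupledTransfer f lam h E (Φ + Ψ) x =
      S.coupledTransfer f lam h E Φ x + S.coupledTransfer f lam h E Ψ x := by
  have : (⇑(weighted h (Φ + Ψ)) : LatticeSpace → 𝕜) =
      fun y => weighted h Φ y + weighted h Ψ y := by
    funext y; simp [weighted, mul_add]
  rw [coupledTransfer_eq, coupledTransfer_eq, coupledTransfer_eq, this, transfer_add, add_div]

theorem coupledTransfer_smul (c : 𝕜) (Φ : C(LatticeSpace, 𝕜)) (x : LatticeSpace) :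
    S.coupledTransfer f lam h E (c • Φ) x = c * S.coupledTransfer f lam h E Φ x := by
  have : (⇑(weighted h (c • Φ)) : LatticeSpace → 𝕜) = fun y => c * weighted h Φ y := by
    funext y; simp [weighted, mul_left_comm]
  rw [coupledTransfer_eq, coupledTransfer_eq, this, transfer_mul_left, mul_div_assoc]

theorem clm_coupledTransfer (T : 𝕜 →L[ℝ] ℝ) (Φ : C(LatticeSpace, 𝕜)) (x : LatticeSpace) :
    T (S.coupledTransfer f lam h E Φ x) =
      S.coupledTransfer f lam h E (fun y => T (Φ y)) x := by
  have h1 : ∀ (r : ℝ) (z : 𝕜), T ((r : 𝕜) * z) = r * T z := fun r z => by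
    rw [← RCLike.real_smul_eq_coe_mul, map_smul, smul_eq_mul]
  rw [coupledTransfer_eq, div_eq_inv_mul, ← RCLike.ofReal_inv, h1, clm_transfer]
  simp only [weighted, ContinuousMap.coe_mk, h1, coupledTransfer, normTransfer, div_eq_inv_mul]
  rfl

/-! ### Normalization, positivity, spread of zeros and the maximum principle -/

variable {lam h E} {f}

theorem coupledTransfer_one (hlam : 0 < lam) (hpos : ∀ x, 0 < h x)
    (hPh : ∀ x, S.transfer f h x = lam * h x) (x : LatticeSpace) :
    S.coupledTransfer f lam h E (fun _ => (1 : 𝕜)) x = 1 := by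
  have key : S.transfer f (fun y => (h y : 𝕜) * 1) (E.symm x) =
      ((lam * h (E.symm x) : ℝ) : 𝕜) := by
    refine tendsto_nhds_unique (S.tendsto_finTransfer f (weighted h (1 : C(LatticeSpace, 𝕜))) _) ?_
    have h1 := (RCLike.continuous_ofReal (K := 𝕜)).continuousAt.tendsto.comp
      (S.tendsto_finTransfer f h (E.symm x))
    rw [hPh] at h1
    refine h1.congr fun k => ?_
    simp [finTransfer, weighted]
  have hne : ((lam * h (E.symm x) : ℝ) : 𝕜) ≠ 0 :=
    RCLike.ofReal_ne_zero.2 (mul_pos hlam (hpos _)).ne'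
  rw [coupledTransfer, normTransfer, key, div_self hne]

theorem coupledTransfer_nonneg (hlam : 0 < lam) (hpos : ∀ x, 0 < h x) (v : C(LatticeSpace, ℝ))
    (hv : ∀ x, 0 ≤ v x) (x : LatticeSpace) : 0 ≤ S.coupledTransfer f lam h E v x := by
  rw [coupledTransfer_eq]
  exact div_nonneg (transfer_nonneg _ _ (fun y => mul_nonneg (hpos y).le (hv y)) _)
    (mul_pos hlam (hpos _)).le

theorem eq_zero_of_coupledTransfer_eq_zero (hlam : 0 < lam) (hpos : ∀ x, 0 < h x)
    (v : C(LatticeSpace, ℝ)) (hv : ∀ x, 0 ≤ v x) (x : LatticeSpace)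
    (hx : S.coupledTransfer f lam h E v x = 0) (ω : ℤ → Fin S.b) :
    v (S.fullBranch ω (E.symm x)) = 0 := by
  by_contra hne
  have h1 : 0 < weighted h v (S.fullBranch ω (E.symm x)) :=
    mul_pos (hpos _) (lt_of_le_of_ne (hv _) (Ne.symm hne))
  have h2 := transfer_pos f (weighted h v) (fun y => mul_nonneg (hpos y).le (hv y)) _ ω h1
  rw [coupledTransfer_eq] at hx
  exact (div_pos h2 (mul_pos hlam (hpos (E.symm x)))).ne' hx

theorem IsHolder.coupledTransfer {CE : ℝ} (hβ : 0 < β) (hf : S.IsHolder β f)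
    (hpos : ∀ x, 0 < h x) (hlog : S.IsHolder β fun x => Real.log (h x)) (hCE : 0 ≤ CE)
    (hE : ∀ x y, S.d (E.symm x) (E.symm y) ≤ CE * S.d x y) {Φ : C(LatticeSpace, 𝕜)}
    (hΦ : S.IsHolder β Φ) : S.IsHolder β (S.coupledTransfer f lam h E Φ) := by
  -- `h = exp (log h)` and `1/h = exp (-log h)`, so both inherit Hölder continuity from `log h`.
  have hh : S.IsHolder β h := by simpa only [Real.exp_log (hpos _)] using hlog.exp hβ
  have hinv : S.IsHolder β fun x => (h x)⁻¹ := by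
    simpa only [Real.exp_neg, Real.exp_log (hpos _)] using hlog.neg.exp hβ
  have h1 : S.IsHolder β (S.transfer f (weighted h Φ)) :=
    IsHolder.transfer hβ hf (hh.ofReal.mul hβ hΦ)
  have h2 := h1.mul hβ ((isHolder_const (lam⁻¹ : 𝕜)).mul hβ (hinv.ofReal (𝕜 := 𝕜)))
  refine (IsHolder.comp_lipschitz hβ (Φ := S.normTransfer f lam h Φ) ?_ hCE hE)
  convert h2 using 2 with x
  simp only [normTransfer, div_eq_mul_inv, RCLike.ofReal_mul, RCLike.ofReal_inv, mul_inv]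
  rfl

/-- A nonnegative fixed function with a zero vanishes identically. -/
theorem eq_zero_of_fixed {CE : ℝ} (hβ : 0 < β) (hlam : 0 < lam) (hpos : ∀ x, 0 < h x)
    (hCE : 0 < CE) (hCE' : CE < S.η⁻¹)
    (hE : ∀ x y, S.d (E.symm x) (E.symm y) ≤ CE * S.d x y)
    (v : C(LatticeSpace, ℝ)) (hvH : S.IsHolder β v) (hv : ∀ x, 0 ≤ v x)
    (hfix : ∀ x, S.coupledTransfer f lam h E v x = v x) (x₀ : LatticeSpace) (hx₀ : v x₀ = 0)
    (z : LatticeSpace) : v z = 0 := by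
  obtain ⟨D, hD, hdD⟩ := S.exists_d_le
  have hη := S.η_pos
  -- Every point lies within `(η C_E) ^ n * D` of a zero of `v`, namely an `n`-th preimage of `x₀`.
  have key : ∀ (n : ℕ) (z : LatticeSpace), ∃ y, v y = 0 ∧ S.d z y ≤ (S.η * CE) ^ n * D := by
    intro n
    induction n with
    | zero => exact fun z => ⟨x₀, hx₀, by simpa using hdD z x₀⟩
    | succ n ih =>
      intro z
      obtain ⟨ω, w, rfl⟩ := S.exists_fullBranch_eq z
      -- With `z = ζ_ω w`, a zero `y` near `E w` is pulled back along the same branch: `ζ_ω (E⁻¹ y)`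
      -- is a zero near `ζ_ω w`, and the distance shrinks by `C_E` and then by `η`.
      obtain ⟨y, hy, hd⟩ := ih (E w)
      refine ⟨S.fullBranch ω (E.symm y), eq_zero_of_coupledTransfer_eq_zero hlam hpos v hv y
        ((hfix y).trans hy) ω, (d_fullBranch_le ω _ _).trans ?_⟩
      have h1 := hE (E w) y
      rw [Equiv.symm_apply_apply] at h1
      calc S.η * S.d w (E.symm y) ≤ S.η * (CE * ((S.η * CE) ^ n * D)) := by
            gcongr
            exact h1.trans (by gcongr)
        _ = _ := by ring
  obtain ⟨C, hC, hH⟩ := hvH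
  have hr : S.η * CE < 1 := by
    have := mul_lt_mul_of_pos_left hCE' hη
    rwa [mul_inv_cancel₀ hη.ne'] at this
  have ht : Tendsto (fun n : ℕ => C * ((S.η * CE) ^ n * D) ^ β) atTop (𝓝 0) := by
    have h1 : Tendsto (fun n : ℕ => (S.η * CE) ^ n * D) atTop (𝓝 0) := by
      simpa using (tendsto_pow_atTop_nhds_zero_of_lt_one (by positivity) hr).mul_const D
    have := (h1.rpow_const (Or.inr hβ.le)).const_mul C
    rwa [Real.zero_rpow hβ.ne', mul_zero] at this
  refine le_antisymm (ge_of_tendsto ht (Eventually.of_forall fun n => ?_)) (hv z)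
  obtain ⟨y, hy, hd⟩ := key n z
  have h1 := hH z y
  rw [hy, sub_zero] at h1
  exact (le_abs_self _).trans (h1.trans (mul_le_mul_of_nonneg_left
    (Real.rpow_le_rpow (S.d_nonneg _ _) hd hβ.le) hC))

theorem coupledTransfer_const_sub (hlam : 0 < lam) (hpos : ∀ x, 0 < h x)
    (hPh : ∀ x, S.transfer f h x = lam * h x) (c : ℝ) (u : C(LatticeSpace, ℝ))
    (x : LatticeSpace) :
    S.coupledTransfer f lam h E (c • (1 : C(LatticeSpace, ℝ)) + (-1 : ℝ) • u) x =
      c - S.coupledTransfer f lam h E u x := by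
  rw [coupledTransfer_add, coupledTransfer_smul, coupledTransfer_smul]
  have : S.coupledTransfer f lam h E (⇑(1 : C(LatticeSpace, ℝ))) x = 1 :=
    coupledTransfer_one hlam hpos hPh x
  rw [this]
  ring

/-- A function that the operator changes by a constant `c` takes, by the maximum principle,
`c ≤ 0`. -/
theorem nonpos_of_coupledTransfer_eq_add (hlam : 0 < lam) (hpos : ∀ x, 0 < h x)
    (hPh : ∀ x, S.transfer f h x = lam * h x) (u : C(LatticeSpace, ℝ)) (c : ℝ)
    (hu : ∀ x, S.coupledTransfer f lam h E u x = u x + c) : c ≤ 0 := by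
  obtain ⟨x₀, -, hmax⟩ := isCompact_univ.exists_isMaxOn Set.univ_nonempty u.continuous.continuousOn
  -- Positivity applied to `max u - u` at the maximum point reads `max u - (max u + c) ≥ 0`.
  have h1 := coupledTransfer_nonneg (S := S) (f := f) (E := E) hlam hpos
    (u x₀ • (1 : C(LatticeSpace, ℝ)) + (-1 : ℝ) • u)
    (fun x => by simpa using hmax (Set.mem_univ x)) x₀
  rw [coupledTransfer_const_sub hlam hpos hPh, hu] at h1
  linarith

/-- The maximum principle for `u` and `-u` kills `c`; then `max u - u` is fixed, nonnegative and has
a zero, so it vanishes. -/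
theorem eq_of_coupledTransfer_eq_add {CE : ℝ} (hβ : 0 < β) (hlam : 0 < lam)
    (hpos : ∀ x, 0 < h x) (hPh : ∀ x, S.transfer f h x = lam * h x)
    (hCE : 0 < CE) (hCE' : CE < S.η⁻¹)
    (hE : ∀ x y, S.d (E.symm x) (E.symm y) ≤ CE * S.d x y)
    (u : C(LatticeSpace, ℝ)) (huH : S.IsHolder β u) (c : ℝ)
    (hu : ∀ x, S.coupledTransfer f lam h E u x = u x + c) : c = 0 ∧ ∀ x y, u x = u y := by
  have hc : c = 0 := by
    refine le_antisymm (nonpos_of_coupledTransfer_eq_add hlam hpos hPh u c hu) ?_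
    refine neg_nonpos.1 (nonpos_of_coupledTransfer_eq_add (f := f) (E := E) hlam hpos hPh
      ((-1 : ℝ) • u) (-c) fun x => ?_)
    rw [coupledTransfer_smul, hu]
    simp
    ring
  subst hc
  obtain ⟨x₀, -, hmax⟩ := isCompact_univ.exists_isMaxOn Set.univ_nonempty u.continuous.continuousOn
  have key : ∀ z, u z = u x₀ := fun z => by
    have h1 := eq_zero_of_fixed (f := f) hβ hlam hpos hCE hCE' hE
      (u x₀ • (1 : C(LatticeSpace, ℝ)) + (-1 : ℝ) • u)
      (by convert (isHolder_const (u x₀)).add huH.neg using 2 with x; simp)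
      (fun x => by simpa using hmax (Set.mem_univ x))
      (fun x => by rw [coupledTransfer_const_sub hlam hpos hPh, hu]; simp; ring)
      x₀ (by simp) z
    simp at h1
    linarith
  exact ⟨rfl, fun x y => (key x).trans (key y).symm⟩

end Coupled

end LatticeSystem

/-! ### Simplicity of the eigenvalue one -/

theorem eigenspace_one_eq_span {K V : Type*} [Field K] [AddCommGroup V] [Module K V]
    {A : Module.End K V} {e : V} (he : A e = e)
    (hA : ∀ (v : V) (c : K), A v = v + c • e → c = 0 ∧ ∃ r : K, v = r • e) :
    A.eigenspace 1 = Submodule.span K {e} := by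
  ext v
  rw [Module.End.mem_eigenspace_iff, one_smul, Submodule.mem_span_singleton]
  constructor
  · intro hv
    obtain ⟨-, r, hr⟩ := hA v 0 (by rw [hv, zero_smul, add_zero])
    exact ⟨r, hr.symm⟩
  · rintro ⟨r, rfl⟩
    rw [map_smul, he]

/-- If `(A - 1) ^ (m + 1) v = 0`, induction puts `(A - 1) v` in the line spanned by `e`, so `A v = v
+ c • e` and `hA` applies. -/
theorem maxGenEigenspace_one_eq_eigenspace {K V : Type*} [Field K] [AddCommGroup V] [Module K V]
    {A : Module.End K V} {e : V} (he : A e = e)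
    (hA : ∀ (v : V) (c : K), A v = v + c • e → c = 0 ∧ ∃ r : K, v = r • e) :
    A.maxGenEigenspace 1 = A.eigenspace 1 := by
  refine le_antisymm (fun v hv => ?_) ((A.genEigenspace 1).mono le_top)
  obtain ⟨m, hm⟩ := Module.End.mem_maxGenEigenspace A 1 v |>.1 hv
  clear hv
  induction m generalizing v with
  | zero =>
    have : v = 0 := by simpa using hm
    rw [this]
    exact Submodule.zero_mem _
  | succ m ih =>
    rw [pow_succ, Module.End.mul_apply] at hm
    have h1 := ih _ hm
    rw [eigenspace_one_eq_span he hA, Submodule.mem_span_singleton] at h1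
    obtain ⟨c, hc⟩ := h1
    obtain ⟨-, r, hr⟩ := hA v c (by rw [hc]; simp)
    rw [eigenspace_one_eq_span he hA, Submodule.mem_span_singleton]
    exact ⟨r, hr.symm⟩

theorem finrank_eigenspace_one {K V : Type*} [Field K] [AddCommGroup V] [Module K V]
    {A : Module.End K V} {e : V} (he : A e = e) (he0 : e ≠ 0)
    (hA : ∀ (v : V) (c : K), A v = v + c • e → c = 0 ∧ ∃ r : K, v = r • e) :
    Module.finrank K (A.eigenspace 1) = 1 := by
  rw [eigenspace_one_eq_span he hA]
  exact finrank_span_singleton he0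

theorem finrank_maxGenEigenspace_one {K V : Type*} [Field K] [AddCommGroup V] [Module K V]
    {A : Module.End K V} {e : V} (he : A e = e) (he0 : e ≠ 0)
    (hA : ∀ (v : V) (c : K), A v = v + c • e → c = 0 ∧ ∃ r : K, v = r • e) :
    Module.finrank K (A.maxGenEigenspace 1) = 1 := by
  rw [maxGenEigenspace_one_eq_eigenspace he hA]
  exact finrank_eigenspace_one he he0 hA

end

/-! ### The operator on `𝒞`, its multiplicities and its nonnegative eigenfunctions -/

theorem mainTheorem8 {𝕜 : Type*} [RCLike 𝕜] (S : LatticeSystem) (β : ℝ) (hβ : 0 < β)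
    (f : S.holderSpace ℝ β)
    (ν : Measure LatticeSpace) [IsProbabilityMeasure ν] (lam : ℝ)
    (hν : S.IsEigenmeasure f.1 ν lam)
    (h : C(LatticeSpace, ℝ)) (hΔ : h ∈ S.Delta β f.1 ν)
    (hPh : ∀ x, S.transfer f.1 h x = lam * h x)
    (E : LatticeSpace ≃ LatticeSpace) (CE : ℝ) (hCE_pos : 0 < CE) (hCE_lt : CE < S.η⁻¹)
    (hE : ∀ (n : ℤ) (x y : LatticeSpace),
      S.d (latticeShift n (E.symm x)) (latticeShift n (E.symm y))
        ≤ CE * S.d (latticeShift n x) (latticeShift n y)) :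
    ∃ 𝓛 : Module.End 𝕜 (S.holderSpace 𝕜 β),
      (∀ (Φ : S.holderSpace 𝕜 β) (x : LatticeSpace),
        (𝓛 Φ).1 x = S.coupledTransfer f.1 lam h E Φ.1 x) ∧
      𝓛.HasEigenvector 1 (S.oneFun 𝕜 β) ∧
      Module.finrank 𝕜 (Module.End.eigenspace (R := 𝕜) (M := S.holderSpace 𝕜 β) 𝓛 1) = 1 ∧
      Module.finrank 𝕜 (Module.End.maxGenEigenspace (R := 𝕜) (M := S.holderSpace 𝕜 β) 𝓛 1) = 1 ∧
      ∀ ψ : S.holderSpace 𝕜 β, 𝓛.HasEigenvector 1 ψ →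
        (∀ x, ∃ r : ℝ, 0 ≤ r ∧ ψ.1 x = (r : 𝕜)) → ∀ x, ψ.1 x ≠ 0 := by
  have hpos := LatticeSystem.pos_of_mem_Delta hΔ
  have hlam : 0 < lam := LatticeSystem.eigenvalue_pos hpos hPh
  have hE0 : ∀ x y, S.d (E.symm x) (E.symm y) ≤ CE * S.d x y := fun x y => by
    have h0 : ∀ x, latticeShift 0 x = x := fun x => funext fun i => congrArg x (add_zero i)
    simpa only [h0] using hE 0 x y
  have hlog := LatticeSystem.isHolder_log_of_mem_Delta hβ hΔ
  have hf := (LatticeSystem.mem_holderSpace_iff hβ f.1).1 f.2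
  have hH : ∀ Φ : S.holderSpace 𝕜 β, S.IsHolder β (S.coupledTransfer f.1 lam h E Φ.1) :=
    fun Φ => LatticeSystem.IsHolder.coupledTransfer hβ hf hpos hlog hCE_pos.le hE0
      ((LatticeSystem.mem_holderSpace_iff hβ Φ.1).1 Φ.2)
  obtain ⟨𝓛, h𝓛⟩ : ∃ 𝓛 : Module.End 𝕜 (S.holderSpace 𝕜 β),
      ∀ (Φ : S.holderSpace 𝕜 β) (x : LatticeSpace),
        (𝓛 Φ).1 x = S.coupledTransfer f.1 lam h E Φ.1 x :=
    ⟨{  toFun := fun Φ => ⟨⟨S.coupledTransfer f.1 lam h E Φ.1, (hH Φ).continuous hβ⟩,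
          (LatticeSystem.mem_holderSpace_iff hβ _).2 (hH Φ)⟩
        map_add' := fun Φ Ψ => Subtype.ext <| ContinuousMap.ext fun x =>
          LatticeSystem.coupledTransfer_add f.1 lam h E Φ.1 Ψ.1 x
        map_smul' := fun c Φ => Subtype.ext <| ContinuousMap.ext fun x =>
          LatticeSystem.coupledTransfer_smul f.1 lam h E c Φ.1 x }, fun _ _ => rfl⟩
  have hone : 𝓛 (S.oneFun 𝕜 β) = S.oneFun 𝕜 β := Subtype.ext <| ContinuousMap.ext fun x =>
    (h𝓛 _ x).trans (LatticeSystem.coupledTransfer_one hlam hpos hPh x)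
  have hone_ne : S.oneFun 𝕜 β ≠ 0 := fun h0 => by
    have := congrArg (fun Φ : S.holderSpace 𝕜 β => Φ.1 0) h0
    exact one_ne_zero this
  have hconst : ∀ (Φ : S.holderSpace 𝕜 β) (c : 𝕜), 𝓛 Φ = Φ + c • S.oneFun 𝕜 β →
      c = 0 ∧ ∃ r : 𝕜, Φ = r • S.oneFun 𝕜 β := by
    intro Φ c hΦ
    have hval : ∀ x, S.coupledTransfer f.1 lam h E Φ.1 x = Φ.1 x + c := fun x => by
      have h1 : (𝓛 Φ).1 x = Φ.1 x + c * 1 := by rw [hΦ]; rfl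
      rwa [mul_one, h𝓛] at h1
    -- A real-linear functional commutes with `ℒ`, so `T ∘ Φ` solves the real equation with constant
    -- `T c`; the real and imaginary parts then determine `c` and `Φ`.
    have key : ∀ T : 𝕜 →L[ℝ] ℝ, T c = 0 ∧ ∀ x y, T (Φ.1 x) = T (Φ.1 y) := fun T =>
      LatticeSystem.eq_of_coupledTransfer_eq_add (f := f.1) hβ hlam hpos hPh hCE_pos hCE_lt hE0
        ⟨fun y => T (Φ.1 y), by fun_prop⟩
        (((LatticeSystem.mem_holderSpace_iff hβ Φ.1).1 Φ.2).comp_clm T) (T c) fun x => by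
          have := LatticeSystem.clm_coupledTransfer (S := S) f.1 lam h E T Φ.1 x
          rw [hval, map_add] at this
          exact this.symm
    have hre := key RCLike.reCLM
    have him := key RCLike.imCLM
    refine ⟨RCLike.ext (by simpa using hre.1) (by simpa using him.1), Φ.1 0,
      Subtype.ext <| ContinuousMap.ext fun x => ?_⟩
    change Φ.1 x = Φ.1 0 * 1
    rw [mul_one]
    exact RCLike.ext (hre.2 x 0) (him.2 x 0)
  refine ⟨𝓛, h𝓛, ⟨Module.End.mem_eigenspace_iff.2 (by rw [hone, one_smul]), hone_ne⟩,
    finrank_eigenspace_one hone hone_ne hconst, finrank_maxGenEigenspace_one hone hone_ne hconst,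
    fun ψ hψ _ x hx => hψ.2 ?_⟩
  -- An eigenfunction is the case `c = 0`, hence a constant, and a single zero makes that constant
  -- `0`.
  have h1 : 𝓛 ψ = ψ + (0 : 𝕜) • S.oneFun 𝕜 β := by
    rw [zero_smul, add_zero]
    exact hψ.apply_eq_smul.trans (one_smul 𝕜 ψ)
  obtain ⟨-, r, rfl⟩ := hconst ψ 0 h1
  have hr : r * 1 = 0 := hx
  rw [mul_one] at hr
  rw [hr, zero_smul]
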